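/- Let $n,m\ge 1$ and let $G(n,m)=SO(n+m)/(SO(n)\times SO(m))$ be the Grassmannian of oriented $n$-planes in $\mathbb{R}^{n+m}$ with its homogeneous metric $ds^2=\sum A_{i\alpha}^2$ (where $T_PG(n,m)\cong \mathrm{Hom}(P,P^\perp)\ni A$); equivalently, $G(n,m)$ is the submanifold $\{e_1\wedge\cdots\wedge e_n : e_1,\dots,e_n \text{ orthonormal}\}$ of the Euclidean space $\wedge^n\mathbb{R}^{n+m}$ with the induced metric. Let $\Omega$ be a simple unit $n$-form on $\mathbb{R}^{n+m}$, dual to the $n$-plane $Q$, i.e. $\Omega=a_1^*\wedge\cdots\wedge a_n^*$ for an orthonormal basis $a_1,\dots,a_n$ of $Q$; regard $\Omega$ as a function on $G(n,m)$ by $\Omega(e_1\wedge\cdots\wedge e_n)=\Omega(e_1,\dots,e_n)$. Let $\Xi\subset G(n,m)$ be the set of oriented $n$-planes $P$ with $\Omega(P)>0$ (i.e. oriented so that the orthogonal projection $P\to Q$ preserves orientation, $Q$ being oriented by $\Omega$) that are graphs over $Q$ of a linear map $L_P:Q\to Q^\perp$ whose singular values $\lambda_1,\dots,\lambda_n$ (the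 eigenvalues of $\sqrt{L_P^TL_P}$) satisfy $|\lambda_i\lambda_j|\le 1$ for all $i\ne j$. Then: (1) $-\ln\Omega$ is convex on $\Xi$: its Hessian is positive semidefinite at every point of $\Xi$, i.e. along every geodesic of $G(n,m)$ the second derivative of $-\ln\Omega$ is nonnegative wherever the geodesic meets $\Xi$; and $-\ln\Omega$ is a convex function of the parameter along every arc of a geodesic that lies in $\Xi$; (2) $\Xi$ properly contains $\{P\in G(n,m) : \Omega(P)\ge \tfrac12\}$. -/

import Mathlib

open scoped ContDiff

noncomputable section

namespace Grassmann

/-- The ambient Euclidean space `ℝ^(n+m)`. -/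
abbrev Ambient (n m : ℕ) : Type := EuclideanSpace ℝ (Fin (n + m))

/-- The space `⋀ⁿ ℝ^(n+m)` of `n`-vectors, with its standard (Gram determinant) inner product. -/
abbrev NVec (n m : ℕ) : Type := ⋀[ℝ]^n (Ambient n m)

/-- The simple `n`-vector `P` is `e₁ ∧ ⋯ ∧ eₙ` for an orthonormal basis `e` of the subspace `V`:
`P` is an oriented `n`-plane whose underlying subspace is `V`. -/
def IsOrientedPlane {n m : ℕ} (P : NVec n m) (V : Submodule ℝ (Ambient n m)) : Prop :=
  ∃ e : Fin n → Ambient n m,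
    Orthonormal ℝ e ∧ Submodule.span ℝ (Set.range e) = V ∧ P = exteriorPower.ιMulti ℝ n e

/-- The Grassmannian `G(n,m) = SO(n+m) / (SO(n) × SO(m))` of oriented `n`-planes in `ℝ^(n+m)`,
as the submanifold of all `e₁ ∧ ⋯ ∧ eₙ` (`e` orthonormal) in the Euclidean space `⋀ⁿ ℝ^(n+m)`.
The metric induced from `⋀ⁿ ℝ^(n+m)` is the homogeneous metric `∑ A_{iα}²`. -/
def Gr (n m : ℕ) : Set (NVec n m) :=
  {P | ∃ V : Submodule ℝ (Ambient n m), IsOrientedPlane P V}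

/-- Tangent vectors of `G(n,m)` at `P`: the velocities of smooth curves in `G(n,m)` through `P`. -/
def IsTangent {n m : ℕ} (P w : NVec n m) : Prop :=
  ∃ c : ℝ → NVec n m,
    ContDiff ℝ ∞ c ∧ (∀ t, c t ∈ Gr n m) ∧ c 0 = P ∧ HasDerivAt c w 0

/-- `γ` is a geodesic of `G(n,m)` on the open set `I` of parameters. The Levi-Civita derivative of
`γ'` along `γ` is the tangential part of `γ''`, so the geodesic equation says that `γ''` is
orthogonal to the tangent space. -/
def IsGeodesicOn {n m : ℕ} (γ : ℝ → NVec n m) (I : Set ℝ) : Prop :=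
  ContDiffOn ℝ ∞ γ I ∧ (∀ t ∈ I, γ t ∈ Gr n m) ∧
    ∀ t ∈ I, ∀ w : NVec n m, IsTangent (γ t) w → inner ℝ (deriv (deriv γ) t) w = 0

/-- The Hessian of `f` is positive semidefinite at every point of `S`: whenever a geodesic (in any
direction) passes through a point of `S`, `f` is twice continuously differentiable along the
geodesic near that point, with nonnegative second derivative there. -/
def HessianNonnegOn {n m : ℕ} (f : NVec n m → ℝ) (S : Set (NVec n m)) : Prop :=
  ∀ (γ : ℝ → NVec n m) (I : Set ℝ), IsOpen I → Set.OrdConnected I → IsGeodesicOn γ I →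
    ∀ t ∈ I, γ t ∈ S →
      ContDiffAt ℝ 2 (fun s => f (γ s)) t ∧ 0 ≤ deriv (deriv (fun s => f (γ s))) t

/-- `f` is a convex function of the parameter along every arc of a geodesic that lies in `S`. -/
def GeodesicallyConvexOn {n m : ℕ} (f : NVec n m → ℝ) (S : Set (NVec n m)) : Prop :=
  ∀ (γ : ℝ → NVec n m) (I : Set ℝ), IsOpen I → Set.OrdConnected I → IsGeodesicOn γ I →
    ∀ J : Set ℝ, J ⊆ I → Convex ℝ J → (∀ t ∈ J, γ t ∈ S) → ConvexOn ℝ J (fun s => f (γ s))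

/-- `Ω` is a simple unit `n`-form dual to the `n`-plane `Q`: `Ω = a₁* ∧ ⋯ ∧ aₙ*` for an
orthonormal basis `a` of `Q`, with `aᵢ* = ⟪aᵢ, ·⟫`. -/
def IsSimpleUnitFormDualTo {n m : ℕ} (Ω : Ambient n m [⋀^Fin n]→ₗ[ℝ] ℝ)
    (Q : Submodule ℝ (Ambient n m)) : Prop :=
  ∃ a : Fin n → Ambient n m, Orthonormal ℝ a ∧ Submodule.span ℝ (Set.range a) = Q ∧
    ∀ v : Fin n → Ambient n m, Ω v = Matrix.det (Matrix.of fun i j => inner ℝ (a i) (v j))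

/-- An `n`-form as a function of `n`-vectors, hence on `G(n,m)`:
`evalForm Ω (e₁ ∧ ⋯ ∧ eₙ) = Ω(e₁, …, eₙ)`. -/
def evalForm {n m : ℕ} (Ω : Ambient n m [⋀^Fin n]→ₗ[ℝ] ℝ) : NVec n m →ₗ[ℝ] ℝ :=
  exteriorPower.alternatingMapLinearEquiv Ω

/-- The graph `{x + L x | x ∈ Q}` of a linear map `L : Q → Qᗮ`. -/
def graphOver {n m : ℕ} (Q : Submodule ℝ (Ambient n m)) (L : Q →ₗ[ℝ] Qᗮ) :
    Submodule ℝ (Ambient n m) :=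
  LinearMap.range (Q.subtype + Qᗮ.subtype ∘ₗ L)

/-- The set `Ξ`: the oriented planes `P` that are graphs over `Q` of a linear map `L : Q → Qᗮ`
whose `n` singular values satisfy `|λᵢ λⱼ| ≤ 1` for `i ≠ j`. The condition `0 < Ω(P)` fixes the
orientation of `P`: the orthogonal projection `P → Q` preserves the orientations, where `Q` is
oriented by `Ω`. -/
def Xi {n m : ℕ} (Ω : Ambient n m [⋀^Fin n]→ₗ[ℝ] ℝ) (Q : Submodule ℝ (Ambient n m)) :
    Set (NVec n m) :=
  {P | 0 < evalForm Ω P ∧ ∃ L : Q →ₗ[ℝ] Qᗮ, IsOrientedPlane P (graphOver Q L) ∧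
    ∀ i j : Fin n, i ≠ j → |L.singularValues i * L.singularValues j| ≤ 1}

end Grassmann

end

/-!
The function `-log Ω` is convex on `Ξ` because, in a frame adapted to the singular value
decomposition of the map `L` whose graph is `P`, its Hessian is `|v|² + ∑ λᵢ λⱼ Dᵢⱼ Dⱼᵢ`, where `Dᵢⱼ` are
the components of the tangent vector `v` along `f₁ ∧ ⋯ ∧ νⱼ ∧ ⋯ ∧ fₙ` (`νⱼ` in position `i`). The
diagonal terms of the sum are nonnegative, and when `|λᵢ λⱼ| ≤ 1` for `i ≠ j` the others are absorbed
by `|v|² ≥ ∑ Dᵢⱼ²`, which is Bessel's inequality in `⋀ⁿ ℝ^(n+m)`.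

The Hessian is computed without lifting the geodesic `γ` to a moving frame. By Cramer's rule,
every `R ∈ G(n,m)` with `g = ⟪P, R⟫ ≠ 0` satisfies `Ω(R) = Ω(P) g det (1 - C)`, where
`Cᵢⱼ = λⱼ ⟪f₁ ∧ ⋯ ∧ νⱼ ∧ ⋯ ∧ fₙ, R⟫ / g` (`IsPrincipalFrame.evalForm_eq`). Along `γ` through `P`, the
equation `|γ|² = 1` gives `g' = 0` and `g'' = -|γ'|²`. The vectors `f₁ ∧ ⋯ ∧ νⱼ ∧ ⋯ ∧ fₙ` are tangent at
`P`, being velocities of rotations, so the geodesic equation gives `C'' = 0`. The second-order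
expansion of the determinant at the identity (`deriv_deriv_det_of_eq_one`) then yields
`(-log Ω)'' = |γ'|² + tr (C'²)`. Principal frames come from an eigenbasis of `LᵀL`
(`exists_isPrincipalFrame`). Convexity along arcs follows from the sign of the second derivative.

For the inclusion, a plane with `Ω(P) ≠ 0` is a graph over `Q`, and `Ω(P) = ∏ᵢ (1 + λᵢ²)^(-1/2)`. So
`Ω(P) ≥ 1/2` forces `(1 + λᵢλⱼ)² ≤ (1 + λᵢ²)(1 + λⱼ²) ≤ 4`, hence `λᵢ λⱼ ≤ 1`. It is proper because `Ξ`
contains the graphs of all maps of rank one, for which `Ω` takes every value in `(0, 1)`.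
-/

open Filter Topology

namespace Grassmann

/-! ### Second derivatives of functions of one real variable -/

theorem differentiableAt_deriv_of_contDiffAt_two {E : Type*} [NormedAddCommGroup E]
    [NormedSpace ℝ E] {f : ℝ → E} {t : ℝ} (hf : ContDiffAt ℝ 2 f t) :
    DifferentiableAt ℝ (deriv f) t := by
  have h : ContDiffAt ℝ 1 (fun s => fderiv ℝ f s 1) t :=
    (hf.fderiv_right (m := 1) (by norm_num)).clm_apply contDiffAt_const
  exact h.differentiableAt (by simp)

theorem eventually_differentiableAt_of_contDiffAt_two {E : Type*} [NormedAddCommGroup E]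
    [NormedSpace ℝ E] {f : ℝ → E} {t : ℝ} (hf : ContDiffAt ℝ 2 f t) :
    ∀ᶠ s in 𝓝 t, DifferentiableAt ℝ f s := by
  filter_upwards [hf.eventually (by simp)] with s hs
  exact hs.differentiableAt (by simp)

theorem deriv_deriv_mul {f g : ℝ → ℝ} {t : ℝ} (hf : ContDiffAt ℝ 2 f t) (hg : ContDiffAt ℝ 2 g t) :
    deriv (deriv fun s => f s * g s) t
      = deriv (deriv f) t * g t + 2 * (deriv f t * deriv g t) + f t * deriv (deriv g) t := by
  have h1 : deriv (fun s => f s * g s) =ᶠ[𝓝 t] fun s => deriv f s * g s + f s * deriv g s := by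
    filter_upwards [eventually_differentiableAt_of_contDiffAt_two hf,
      eventually_differentiableAt_of_contDiffAt_two hg] with s hfs hgs
    exact deriv_fun_mul hfs hgs
  have hf0 := (hf.differentiableAt (by simp)).hasDerivAt
  have hg0 := (hg.differentiableAt (by simp)).hasDerivAt
  have hf1 := (differentiableAt_deriv_of_contDiffAt_two hf).hasDerivAt
  have hg1 := (differentiableAt_deriv_of_contDiffAt_two hg).hasDerivAt
  rw [h1.deriv_eq, ((hf1.fun_mul hg0).fun_add (hf0.fun_mul hg1)).deriv]
  ring

theorem deriv_deriv_neg_log {f : ℝ → ℝ} {t : ℝ} (hf : ContDiffAt ℝ 2 f t) (h0 : f t ≠ 0) :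
    deriv (deriv fun s => -Real.log (f s)) t
      = (deriv f t / f t) ^ 2 - deriv (deriv f) t / f t := by
  have h1 : deriv (fun s => -Real.log (f s)) =ᶠ[𝓝 t] fun s => -(deriv f s / f s) := by
    filter_upwards [eventually_differentiableAt_of_contDiffAt_two hf,
      hf.continuousAt.eventually_ne h0] with s hfs hs
    exact (hfs.hasDerivAt.log hs).fun_neg.deriv
  have hf0 := (hf.differentiableAt (by simp)).hasDerivAt
  have hf1 := (differentiableAt_deriv_of_contDiffAt_two hf).hasDerivAt
  rw [h1.deriv_eq, (hf1.fun_div hf0 h0).fun_neg.deriv]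
  field_simp
  ring

theorem deriv_continuousLinearMap_comp {E : Type*} [NormedAddCommGroup E] [NormedSpace ℝ E]
    (ℓ : E →L[ℝ] ℝ) {γ : ℝ → E} {t : ℝ} (hγ : DifferentiableAt ℝ γ t) :
    deriv (fun s => ℓ (γ s)) t = ℓ (deriv γ t) :=
  (ℓ.hasFDerivAt.comp_hasDerivAt t hγ.hasDerivAt).deriv

theorem deriv_deriv_continuousLinearMap_comp {E : Type*} [NormedAddCommGroup E] [NormedSpace ℝ E]
    (ℓ : E →L[ℝ] ℝ) {γ : ℝ → E} {t : ℝ} (hγ : ContDiffAt ℝ 2 γ t) :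
    deriv (deriv fun s => ℓ (γ s)) t = ℓ (deriv (deriv γ) t) := by
  have h1 : deriv (fun s => ℓ (γ s)) =ᶠ[𝓝 t] fun s => ℓ (deriv γ s) := by
    filter_upwards [eventually_differentiableAt_of_contDiffAt_two hγ] with s hs
    exact deriv_continuousLinearMap_comp ℓ hs
  rw [h1.deriv_eq, deriv_continuousLinearMap_comp ℓ (differentiableAt_deriv_of_contDiffAt_two hγ)]

/-- A curve on the unit sphere is orthogonal to its velocity, and the radial part of its acceleration
is minus its squared speed. -/
theorem inner_deriv_deriv_of_norm_eq_one {E : Type*} [NormedAddCommGroup E]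
    [InnerProductSpace ℝ E] {γ : ℝ → E} {t : ℝ} (hγ : ContDiffAt ℝ 2 γ t)
    (h1 : ∀ᶠ s in 𝓝 t, inner ℝ (γ s) (γ s) = 1) :
    inner ℝ (γ t) (deriv γ t) = 0 ∧
      inner ℝ (γ t) (deriv (deriv γ) t) = -‖deriv γ t‖ ^ 2 := by
  have key : ∀ᶠ s in 𝓝 t, inner ℝ (γ s) (deriv γ s) = (0 : ℝ) := by
    filter_upwards [eventually_differentiableAt_of_contDiffAt_two hγ,
      h1.eventually_nhds] with s hs hs1
    have h := (hs.hasDerivAt.inner ℝ hs.hasDerivAt).deriv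
    have hc : (fun s => inner ℝ (γ s) (γ s)) =ᶠ[𝓝 s] fun _ => (1 : ℝ) := hs1
    rw [hc.deriv_eq, deriv_const, real_inner_comm (γ s) (deriv γ s)] at h
    linarith
  refine ⟨key.self_of_nhds, ?_⟩
  have h := ((hγ.differentiableAt (by simp)).hasDerivAt.inner ℝ
    (differentiableAt_deriv_of_contDiffAt_two hγ).hasDerivAt).deriv
  have hc : (fun s => inner ℝ (γ s) (deriv γ s)) =ᶠ[𝓝 t] fun _ => (0 : ℝ) := key
  rw [hc.deriv_eq, deriv_const, real_inner_self_eq_norm_sq] at h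
  linarith

/-- Dividing by a function equal to `1` to first order does not change the two-jet of a function
vanishing at `t`. -/
theorem deriv_div_of_eq_one {q g : ℝ → ℝ} {t : ℝ} (hq : ContDiffAt ℝ 2 q t)
    (hg : ContDiffAt ℝ 2 g t) (hq0 : q t = 0) (hg1 : g t = 1) (hg' : deriv g t = 0) :
    deriv (fun s => q s / g s) t = deriv q t ∧
      deriv (deriv fun s => q s / g s) t = deriv (deriv q) t := by
  have hg0 : g t ≠ 0 := by simp [hg1]
  have hc : ContDiffAt ℝ 2 (fun s => q s / g s) t := hq.div hg hg0
  have e : q =ᶠ[𝓝 t] fun s => q s / g s * g s := by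
    filter_upwards [hg.continuousAt.eventually_ne hg0] with s hs
    rw [div_mul_cancel₀ _ hs]
  have h1 : deriv (fun s => q s / g s) t = deriv q t := by
    rw [deriv_fun_div (hq.differentiableAt (by simp)) (hg.differentiableAt (by simp)) hg0]
    simp [hq0, hg1]
  refine ⟨h1, ?_⟩
  have h2 := deriv_deriv_mul hc hg
  rw [← e.deriv.deriv_eq] at h2
  simp only [hg1, hg', hq0, mul_one, mul_zero, zero_div, zero_mul, add_zero] at h2
  exact h2.symm

/-! ### Second-order expansion of the determinant at the identity matrix -/

section Det

variable {n : ℕ}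

/-- Jacobi's formula for the derivative of a determinant. -/
theorem hasDerivAt_det {X : ℝ → Matrix (Fin n) (Fin n) ℝ} {X' : Matrix (Fin n) (Fin n) ℝ} {t : ℝ}
    (h : ∀ i j, HasDerivAt (fun s => X s i j) (X' i j) t) :
    HasDerivAt (fun s => (X s).det) ((X t).adjugate * X').trace t := by
  have e : ((X t).adjugate * X').trace = ∑ k, ((X t).updateCol k fun j => X' j k).det := by
    simp only [Matrix.trace, Matrix.diag_apply, ← Matrix.cramer_apply,
      Matrix.cramer_eq_adjugate_mulVec]
    rfl
  simp only [e, Matrix.det_apply]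
  rw [Finset.sum_comm]
  refine HasDerivAt.fun_sum fun σ _ => ?_
  have := (HasDerivAt.fun_finsetProd (u := Finset.univ) fun i _ => h (σ i) i).fun_const_smul
    (Equiv.Perm.sign σ)
  convert this using 1
  rw [Finset.smul_sum]
  refine Finset.sum_congr rfl fun k _ => ?_
  congr 1
  rw [← Finset.mul_prod_erase Finset.univ _ (Finset.mem_univ k), mul_comm]
  simp only [Matrix.updateCol_self, smul_eq_mul]
  congr 1
  refine Finset.prod_congr rfl fun i hi => ?_
  rw [Matrix.updateCol_ne (Finset.ne_of_mem_erase hi)]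

theorem contDiffAt_det {X : ℝ → Matrix (Fin n) (Fin n) ℝ} {t : ℝ} {k : WithTop ℕ∞}
    (hX : ∀ i j, ContDiffAt ℝ k (fun s => X s i j) t) :
    ContDiffAt ℝ k (fun s => (X s).det) t := by
  simp only [Matrix.det_apply]
  refine ContDiffAt.sum fun σ _ => ContDiffAt.const_smul _ ?_
  exact contDiffAt_prod fun i _ => hX _ _

theorem deriv_det_of_eq_one {X : ℝ → Matrix (Fin n) (Fin n) ℝ} {t : ℝ}
    (hX : ∀ i j, DifferentiableAt ℝ (fun s => X s i j) t) (h1 : X t = 1) :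
    deriv (fun s => (X s).det) t = ∑ i, deriv (fun s => X s i i) t := by
  have := (hasDerivAt_det (X' := Matrix.of fun i j => deriv (fun s => X s i j) t)
    fun i j => (hX i j).hasDerivAt).deriv
  rw [this, h1]
  simp [Matrix.trace]

/-- The derivative of the adjugate at the identity matrix, obtained by differentiating
`adjugate X * X = det X • 1`. -/
theorem hasDerivAt_adjugate_of_eq_one {X : ℝ → Matrix (Fin n) (Fin n) ℝ} {t : ℝ}
    {X' : Matrix (Fin n) (Fin n) ℝ} (h : ∀ i j, HasDerivAt (fun s => X s i j) (X' i j) t)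
    (h1 : X t = 1) (i j : Fin n) :
    HasDerivAt (fun s => (X s).adjugate i j) (X'.trace * (1 : Matrix (Fin n) (Fin n) ℝ) i j - X' i j) t := by
  have hd : ∀ i j, DifferentiableAt ℝ (fun s => (X s).adjugate i j) t := by
    intro i j
    simp only [Matrix.adjugate_apply]
    refine (hasDerivAt_det (X' := X'.updateRow j 0) fun a b => ?_).differentiableAt
    by_cases ha : a = j
    · subst ha; simpa using hasDerivAt_const _ _
    · simpa [Matrix.updateRow_ne ha] using h a b
  have h2 : HasDerivAt (fun s => ((X s).adjugate * X s) i j)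
      (∑ k, (deriv (fun s => (X s).adjugate i k) t * X t k j
        + (X t).adjugate i k * X' k j)) t := by
    simp only [Matrix.mul_apply]
    exact HasDerivAt.fun_sum fun k _ => (hd i k).hasDerivAt.fun_mul (h k j)
  have h3 : HasDerivAt (fun s => ((X s).adjugate * X s) i j)
      (X'.trace * (1 : Matrix (Fin n) (Fin n) ℝ) i j) t := by
    simp only [Matrix.adjugate_mul, Matrix.smul_apply, smul_eq_mul]
    have := hasDerivAt_det h
    rw [h1, Matrix.adjugate_one, one_mul] at this
    exact this.mul_const _
  have h4 := h2.unique h3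
  rw [h1, Matrix.adjugate_one, Finset.sum_add_distrib, ← Matrix.mul_apply, one_mul] at h4
  simp only [Matrix.one_apply, mul_ite, mul_one, mul_zero, Finset.sum_ite_eq', Finset.mem_univ,
    if_true] at h4
  refine (hd i j).hasDerivAt.congr_deriv ?_
  simp only [Matrix.one_apply, mul_ite, mul_one, mul_zero]
  linarith

/-- At the identity matrix, `(det X)'' = (tr X')² - tr (X'²) + tr X''`. -/
theorem deriv_deriv_det_of_eq_one {X : ℝ → Matrix (Fin n) (Fin n) ℝ} {t : ℝ}
    (hX : ∀ i j, ContDiffAt ℝ 2 (fun s => X s i j) t) (h1 : X t = 1) :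
    deriv (deriv fun s => (X s).det) t
      = (∑ i, deriv (fun s => X s i i) t) ^ 2
        - ∑ i, ∑ j, deriv (fun s => X s i j) t * deriv (fun s => X s j i) t
        + ∑ i, deriv (deriv fun s => X s i i) t := by
  set Y : ℝ → Matrix (Fin n) (Fin n) ℝ := fun s => Matrix.of fun i j => deriv (fun r => X r i j) s
  have e : deriv (fun s => (X s).det) =ᶠ[𝓝 t] fun s => ∑ i, ∑ j, (X s).adjugate i j * Y s j i := by
    have : ∀ᶠ s in 𝓝 t, ∀ i j, DifferentiableAt ℝ (fun s => X s i j) s :=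
      eventually_all.2 fun i => eventually_all.2 fun j =>
        eventually_differentiableAt_of_contDiffAt_two (hX i j)
    filter_upwards [this] with s hs
    rw [(hasDerivAt_det (X' := Y s) fun i j => (hs i j).hasDerivAt).deriv]
    simp [Matrix.trace, Matrix.mul_apply]
  have hA := hasDerivAt_adjugate_of_eq_one (X' := Y t)
    (fun i j => ((hX i j).differentiableAt (by simp)).hasDerivAt) h1
  have hY : ∀ i j, HasDerivAt (fun s => Y s i j) (deriv (deriv fun r => X r i j) t) t :=
    fun i j => (differentiableAt_deriv_of_contDiffAt_two (hX i j)).hasDerivAt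
  have hD := HasDerivAt.fun_sum (u := Finset.univ) fun i _ =>
    HasDerivAt.fun_sum (u := Finset.univ) fun j _ => (hA i j).fun_mul (hY j i)
  rw [e.deriv_eq, hD.deriv, h1, Matrix.adjugate_one]
  simp only [Matrix.one_apply, sub_mul,
    Finset.sum_add_distrib, Finset.sum_sub_distrib, mul_ite, ite_mul, mul_one, one_mul, mul_zero,
    zero_mul, Finset.sum_ite_eq, Finset.mem_univ, if_true, ← Finset.mul_sum]
  rw [sq]
  rfl

end Det

/-! ### Orthonormal families -/

section InnerProductSpace

variable {E : Type*} [NormedAddCommGroup E] [InnerProductSpace ℝ E]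

/-- Parseval's identity on the span of an orthonormal family. -/
theorem inner_eq_sum_of_mem_span {ι : Type*} [Fintype ι] {e : ι → E} (he : Orthonormal ℝ e) {x : E}
    (hx : x ∈ Submodule.span ℝ (Set.range e)) (y : E) :
    inner ℝ x y = ∑ k, inner ℝ x (e k) * inner ℝ (e k) y := by
  classical
  induction hx using Submodule.span_induction with
  | mem x hx =>
    obtain ⟨i, rfl⟩ := hx
    simp [orthonormal_iff_ite.1 he]
  | zero => simp
  | add x y _ _ hx hy => simp [inner_add_left, add_mul, Finset.sum_add_distrib, hx, hy]
  | smul c x _ hx => simp [inner_smul_left, mul_assoc, ← Finset.mul_sum, hx]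

theorem orthonormal_update {ι : Type*} [DecidableEq ι] {f : ι → E} (hf : Orthonormal ℝ f) {j : ι}
    {x : E} (hx1 : inner ℝ x x = (1 : ℝ)) (hx : ∀ k, k ≠ j → inner ℝ (f k) x = (0 : ℝ)) :
    Orthonormal ℝ (Function.update f j x) := by
  rw [orthonormal_iff_ite]
  intro a b
  by_cases ha : a = j <;> by_cases hb : b = j
  · subst ha; subst hb; simpa using hx1
  · subst ha
    simpa [Function.update_of_ne hb, Ne.symm hb, real_inner_comm] using hx b hb
  · subst hb
    simp [ha, hx a ha]
  · simp [Function.update_of_ne ha, Function.update_of_ne hb, orthonormal_iff_ite.1 hf]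

/-- Bessel's inequality for an orthogonal family of vectors of norm at most `1`, some of which may
vanish. -/
theorem sum_sq_inner_le_of_pairwise_orthogonal {ι : Type*} [Fintype ι] {w : ι → E}
    (hw : ∀ a b, a ≠ b → inner ℝ (w a) (w b) = 0) (hw1 : ∀ a, ‖w a‖ ≤ 1) (v : E) :
    ∑ a, inner ℝ (w a) v ^ 2 ≤ ‖v‖ ^ 2 := by
  have h0 : 0 ≤ ‖v - ∑ a, inner ℝ (w a) v • w a‖ ^ 2 := sq_nonneg _
  have h1 : ‖∑ a, inner ℝ (w a) v • w a‖ ^ 2 = ∑ a, inner ℝ (w a) v ^ 2 * ‖w a‖ ^ 2 := by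
    rw [← real_inner_self_eq_norm_sq, sum_inner]
    refine Finset.sum_congr rfl fun a _ => ?_
    rw [inner_sum, Finset.sum_eq_single a]
    · rw [inner_smul_left, inner_smul_right, real_inner_self_eq_norm_sq]
      simp only [conj_trivial]
      ring
    · intro b _ hb
      rw [inner_smul_left, inner_smul_right, hw a b hb.symm]
      simp
    · simp
  have h2 : inner ℝ v (∑ a, inner ℝ (w a) v • w a) = ∑ a, inner ℝ (w a) v ^ 2 := by
    rw [inner_sum]
    refine Finset.sum_congr rfl fun a _ => ?_
    rw [inner_smul_right, real_inner_comm, sq]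
  have h3 : ∑ a, inner ℝ (w a) v ^ 2 * ‖w a‖ ^ 2 ≤ ∑ a, inner ℝ (w a) v ^ 2 :=
    Finset.sum_le_sum fun a _ =>
      mul_le_of_le_one_right (sq_nonneg _) (pow_le_one₀ (norm_nonneg _) (hw1 a))
  rw [norm_sub_sq_real, h1, h2] at h0
  linarith

/-- The determinant of the change of basis between two orthonormal bases of a subspace is `±1`. -/
theorem sq_det_inner_eq_one {n : ℕ} {e f : Fin n → E} (he : Orthonormal ℝ e) (hf : Orthonormal ℝ f)
    (h : ∀ i, f i ∈ Submodule.span ℝ (Set.range e)) :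
    (Matrix.of fun i j => inner ℝ (f i) (e j)).det ^ 2 = 1 := by
  set U : Matrix (Fin n) (Fin n) ℝ := Matrix.of fun i j => inner ℝ (f i) (e j)
  have hU : U * U.transpose = 1 := by
    ext i j
    have := inner_eq_sum_of_mem_span he (h i) (f j)
    rw [orthonormal_iff_ite.1 hf] at this
    rw [Matrix.one_apply, this, Matrix.mul_apply]
    exact Finset.sum_congr rfl fun k _ => by simp [U, real_inner_comm]
  have := congrArg Matrix.det hU
  rwa [Matrix.det_mul, Matrix.det_transpose, Matrix.det_one, ← sq] at this

end InnerProductSpace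

/-! ### Decomposable unit `n`-vectors and their tangent vectors -/

section Wedge

variable {n m : ℕ}

theorem inner_wedge_self {f : Fin n → Ambient n m} (hf : Orthonormal ℝ f) :
    inner ℝ (exteriorPower.ιMulti ℝ n f) (exteriorPower.ιMulti ℝ n f) = (1 : ℝ) := by
  rw [exteriorPower.inner_ιMulti_self, Matrix.gram_eq_one_iff_orthonormal.2 hf, Matrix.det_one]

theorem norm_wedge {f : Fin n → Ambient n m} (hf : Orthonormal ℝ f) :
    ‖exteriorPower.ιMulti ℝ n f‖ = 1 := by
  rw [norm_eq_sqrt_real_inner, inner_wedge_self hf, Real.sqrt_one]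

theorem inner_self_of_mem_Gr {P : NVec n m} (hP : P ∈ Gr n m) : inner ℝ P P = (1 : ℝ) := by
  obtain ⟨_, e, he, _, rfl⟩ := hP
  exact inner_wedge_self he

/-- Two orthonormal bases of the same subspace have the same wedge product up to sign. -/
theorem wedge_eq_or_eq_neg {e f : Fin n → Ambient n m} (he : Orthonormal ℝ e)
    (hf : Orthonormal ℝ f) (h : ∀ i, f i ∈ Submodule.span ℝ (Set.range e)) :
    exteriorPower.ιMulti ℝ n e = exteriorPower.ιMulti ℝ n f ∨
      exteriorPower.ιMulti ℝ n e = -exteriorPower.ιMulti ℝ n f := by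
  have h1 : inner ℝ (exteriorPower.ιMulti ℝ n e) (exteriorPower.ιMulti ℝ n f) =
      (Matrix.of fun i j => inner ℝ (f i) (e j)).det := by
    rw [exteriorPower.inner_ιMulti_ιMulti]
    simp only [real_inner_comm]
  rcases sq_eq_sq_iff_eq_or_eq_neg.1 ((sq_det_inner_eq_one he hf h).trans (one_pow 2).symm) with h2 | h2
  · left
    rw [← inner_eq_one_iff_of_norm_eq_one (𝕜 := ℝ) (norm_wedge he) (norm_wedge hf), h1, h2]
  · right
    rw [← inner_eq_one_iff_of_norm_eq_one (𝕜 := ℝ) (norm_wedge he)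
      (by rw [norm_neg, norm_wedge hf]), inner_neg_right, h1, h2, neg_neg]

/-- The vectors obtained by replacing one factor of `f₁ ∧ ⋯ ∧ fₙ` by a vector normal to `f` are
orthogonal to each other when the replaced positions differ, and otherwise have the same inner
product as the normal vectors. -/
theorem inner_wedge_update {f : Fin n → Ambient n m} (hf : Orthonormal ℝ f) {x y : Ambient n m}
    (hx : ∀ i, inner ℝ (f i) x = 0) (hy : ∀ i, inner ℝ (f i) y = 0) (j l : Fin n) :
    inner ℝ (exteriorPower.ιMulti ℝ n (Function.update f j x))
      (exteriorPower.ιMulti ℝ n (Function.update f l y)) = if j = l then inner ℝ x y else 0 := by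
  have hx' : ∀ i, inner ℝ x (f i) = 0 := fun i => by rw [real_inner_comm, hx]
  rw [exteriorPower.inner_ιMulti_ιMulti]
  split_ifs with h
  · subst h
    rw [show (Matrix.of fun a b => inner ℝ (Function.update f j x b) (Function.update f j y a))
      = Matrix.diagonal (Function.update (1 : Fin n → ℝ) j (inner ℝ x y)) from ?_]
    · rw [Matrix.det_diagonal, Finset.prod_update_of_mem (Finset.mem_univ j)]
      simp
    · ext a b
      rw [Matrix.of_apply, Matrix.diagonal_apply]
      by_cases ha : a = j <;> by_cases hb : b = j
      · subst ha; subst hb; simp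
      · subst ha; simp [Function.update_of_ne hb, hy, Ne.symm hb]
      · subst hb; simp [hx', ha]
      · simp [Function.update_of_ne ha, Function.update_of_ne hb, orthonormal_iff_ite.1 hf, eq_comm]
  · refine Matrix.det_eq_zero_of_row_eq_zero j fun b => ?_
    rw [Matrix.of_apply, Function.update_of_ne h]
    by_cases hb : b = j
    · subst hb; simp [hx']
    · rw [Function.update_of_ne hb, orthonormal_iff_ite.1 hf, if_neg hb]

/-- Replacing `f j` by a unit normal vector `x` gives a tangent vector: the velocity of the rotation of
`f j` towards `x`. -/
theorem isTangent_wedge_update {f : Fin n → Ambient n m} (hf : Orthonormal ℝ f) {x : Ambient n m}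
    (hx : ∀ i, inner ℝ (f i) x = 0) (hx1 : ‖x‖ = 1) (j : Fin n) :
    IsTangent (exteriorPower.ιMulti ℝ n f)
      (exteriorPower.ιMulti ℝ n (Function.update f j x)) := by
  have hx' : ∀ i, inner ℝ x (f i) = 0 := fun i => by rw [real_inner_comm, hx]
  have e : ∀ t : ℝ, exteriorPower.ιMulti ℝ n (Function.update f j
      (Real.cos t • f j + Real.sin t • x)) = Real.cos t • exteriorPower.ιMulti ℝ n f
        + Real.sin t • exteriorPower.ιMulti ℝ n (Function.update f j x) := by
    intro t
    rw [AlternatingMap.map_update_add, AlternatingMap.map_update_smul,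
      AlternatingMap.map_update_smul, Function.update_eq_self]
  refine ⟨fun t => exteriorPower.ιMulti ℝ n (Function.update f j
      (Real.cos t • f j + Real.sin t • x)), ?_, fun t => ⟨_, _, ?_, rfl, rfl⟩, by simp, ?_⟩
  · simp only [e]
    fun_prop
  · have hu : inner ℝ (Real.cos t • f j + Real.sin t • x) (Real.cos t • f j + Real.sin t • x)
        = (1 : ℝ) := by
      simp only [inner_add_left, inner_add_right, inner_smul_left, inner_smul_right,
        real_inner_self_eq_norm_sq, hf.1 j, hx1, hx, real_inner_comm (f j) x, conj_trivial]
      nlinarith [Real.sin_sq_add_cos_sq t]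
    exact orthonormal_update hf hu fun k hk => by
      rw [inner_add_right, inner_smul_right, inner_smul_right, hx, hf.inner_eq_zero hk]
      simp
  · simp only [e]
    have h := ((Real.hasDerivAt_cos 0).smul_const (exteriorPower.ιMulti ℝ n f)).fun_add
      ((Real.hasDerivAt_sin 0).smul_const
        (exteriorPower.ιMulti ℝ n (Function.update f j x)))
    simpa using h

theorem evalForm_wedge (Ω : Ambient n m [⋀^Fin n]→ₗ[ℝ] ℝ) (v : Fin n → Ambient n m) :
    evalForm Ω (exteriorPower.ιMulti ℝ n v) = Ω v := by
  simp [evalForm]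

theorem inner_wedge_update_wedge {f : Fin n → Ambient n m} {x : Ambient n m}
    (hx : ∀ i, inner ℝ (f i) x = 0) (j : Fin n) :
    inner ℝ (exteriorPower.ιMulti ℝ n (Function.update f j x)) (exteriorPower.ιMulti ℝ n f)
      = (0 : ℝ) := by
  rw [exteriorPower.inner_ιMulti_ιMulti]
  refine Matrix.det_eq_zero_of_column_eq_zero j fun a => ?_
  rw [Matrix.of_apply, Function.update_self, real_inner_comm, hx]

end Wedge

/-! ### Principal frames and the second derivative along geodesics -/

variable {n m : ℕ}

/-- A frame adapted to the relative position of `P` and of the plane `Q` dual to `Ω`. Here `f` is an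
orthonormal basis of `P`, oriented by `P`, and `ν i` is the unit normal to `P` in the plane of the
`i`-th principal angle `θᵢ`, so that `lam i = tan θᵢ` is the slope and `s i = cos θᵢ`. The field
`form` says that `Ω` is the wedge product of the duals of the vectors `s i • (f i - lam i • ν i)`,
which for the frames constructed below are an orthonormal basis of `Q`. When `lam i = 0` the normal
`ν i` plays no role and may vanish, which covers the case where `Qᗮ` has dimension less than `n`. -/
structure IsPrincipalFrame (Ω : Ambient n m [⋀^Fin n]→ₗ[ℝ] ℝ) (P : NVec n m) (lam s : Fin n → ℝ)
    (f ν : Fin n → Ambient n m) : Prop where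
  orthonormal : Orthonormal ℝ f
  wedge : exteriorPower.ιMulti ℝ n f = P
  normal_orthogonal : ∀ i j, i ≠ j → inner ℝ (ν i) (ν j) = 0
  normal_unit : ∀ i, ν i = 0 ∨ ‖ν i‖ = 1
  inner_normal : ∀ i j, inner ℝ (f i) (ν j) = 0
  form : ∀ v : Fin n → Ambient n m,
    Ω v = Matrix.det (Matrix.of fun i j => s i * (inner ℝ (f i) (v j) - lam i * inner ℝ (ν i) (v j)))
  scale_pos : ∀ i, 0 < s i
  scale_sq : ∀ i, s i ^ 2 * (1 + lam i ^ 2) = 1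

namespace IsPrincipalFrame

variable {Ω : Ambient n m [⋀^Fin n]→ₗ[ℝ] ℝ} {P : NVec n m} {lam s : Fin n → ℝ}
  {f ν : Fin n → Ambient n m}

theorem prod_scale_pos (F : IsPrincipalFrame Ω P lam s f ν) : 0 < ∏ i, s i :=
  Finset.prod_pos fun i _ => F.scale_pos i

/-- In terms of the matrices `N` and `K` of inner products of a basis of `R` with `f` and with
`lam i • ν i`, this is `det (N - K) = det N * det (1 - N⁻¹ K)`, with `N⁻¹` given by Cramer's rule. -/
theorem evalForm_eq (F : IsPrincipalFrame Ω P lam s f ν) {R : NVec n m} (hR : R ∈ Gr n m)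
    (hg : inner ℝ P R ≠ (0 : ℝ)) :
    evalForm Ω R = (∏ i, s i) * (inner ℝ P R * Matrix.det (1 - Matrix.of fun j i =>
      lam i * inner ℝ (exteriorPower.ιMulti ℝ n (Function.update f j (ν i))) R / inner ℝ P R)) := by
  obtain ⟨_, e, -, -, rfl⟩ := hR
  set N : Matrix (Fin n) (Fin n) ℝ := Matrix.of fun a b => inner ℝ (f b) (e a) with hN
  set K : Matrix (Fin n) (Fin n) ℝ := Matrix.of fun a i => lam i * inner ℝ (ν i) (e a) with hK
  have hdet : inner ℝ P (exteriorPower.ιMulti ℝ n e) = N.det := by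
    rw [← F.wedge, exteriorPower.inner_ιMulti_ιMulti]
  rw [hdet] at hg ⊢
  have hC : (Matrix.of fun j i => lam i * inner ℝ (exteriorPower.ιMulti ℝ n
      (Function.update f j (ν i))) (exteriorPower.ιMulti ℝ n e) / N.det)
      = N.det⁻¹ • (N.adjugate * K) := by
    ext j i
    have h1 : inner ℝ (exteriorPower.ιMulti ℝ n (Function.update f j (ν i)))
        (exteriorPower.ιMulti ℝ n e) = N.cramer (fun a => inner ℝ (ν i) (e a)) j := by
      rw [exteriorPower.inner_ιMulti_ιMulti, Matrix.cramer_apply]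
      congr 1
      ext a b
      by_cases hb : b = j
      · subst hb; simp
      · simp [hb, hN]
    rw [Matrix.of_apply, h1, Matrix.cramer_eq_adjugate_mulVec, Matrix.smul_apply, Matrix.mul_apply,
      Matrix.mulVec, dotProduct, div_eq_inv_mul, smul_eq_mul, Finset.mul_sum]
    congr 1
    exact Finset.sum_congr rfl fun k _ => by simp only [hK, Matrix.of_apply]; ring
  have hfac : N * (1 - N.det⁻¹ • (N.adjugate * K)) = N - K := by
    rw [mul_sub, mul_one, Matrix.mul_smul, ← mul_assoc, Matrix.mul_adjugate, Matrix.smul_mul,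
      one_mul, smul_smul, inv_mul_cancel₀ hg, one_smul]
  rw [hC, ← Matrix.det_mul, hfac, evalForm_wedge, F.form, ← Matrix.det_transpose (N - K),
    ← Matrix.det_mul_column]
  rfl

theorem evalForm_self (F : IsPrincipalFrame Ω P lam s f ν) : evalForm Ω P = ∏ i, s i := by
  have h1 : inner ℝ P P = (1 : ℝ) := by rw [← F.wedge, inner_wedge_self F.orthonormal]
  rw [F.evalForm_eq ⟨_, f, F.orthonormal, rfl, F.wedge.symm⟩ (by rw [h1]; exact one_ne_zero), h1, ← F.wedge]
  simp only [inner_wedge_update_wedge fun i => F.inner_normal i _]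
  rw [show (Matrix.of fun j i : Fin n => lam i * 0 / 1) = (0 : Matrix (Fin n) (Fin n) ℝ) by
    ext; simp]
  simp

theorem norm_normal_le (F : IsPrincipalFrame Ω P lam s f ν) (i : Fin n) : ‖ν i‖ ≤ 1 := by
  rcases F.normal_unit i with h | h <;> simp [h]

/-- The expression shown to be nonnegative is the Hessian of `-log Ω` at `P` in the direction `v`. -/
theorem hessian_nonneg (F : IsPrincipalFrame Ω P lam s f ν)
    (hlam : ∀ i j, i ≠ j → |lam i * lam j| ≤ 1) (v : NVec n m) :
    0 ≤ ‖v‖ ^ 2 + ∑ i, ∑ j,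
      (lam j * inner ℝ (exteriorPower.ιMulti ℝ n (Function.update f i (ν j))) v) *
      (lam i * inner ℝ (exteriorPower.ιMulti ℝ n (Function.update f j (ν i))) v) := by
  set D : Fin n → Fin n → ℝ := fun i j =>
    inner ℝ (exteriorPower.ιMulti ℝ n (Function.update f i (ν j))) v with hD
  have hbessel : ∑ i, ∑ j, D i j ^ 2 ≤ ‖v‖ ^ 2 := by
    rw [← Fintype.sum_prod_type']
    refine sum_sq_inner_le_of_pairwise_orthogonal
      (w := fun p : Fin n × Fin n => exteriorPower.ιMulti ℝ n (Function.update f p.1 (ν p.2)))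
      (fun a b hab => ?_) (fun a => ?_) v
    · rw [inner_wedge_update F.orthonormal (fun i => F.inner_normal i _)
        (fun i => F.inner_normal i _)]
      split_ifs with h
      · exact F.normal_orthogonal _ _ fun h' => hab (Prod.ext h h')
      · rfl
    · have := inner_wedge_update F.orthonormal (fun i => F.inner_normal i a.2)
        (fun i => F.inner_normal i a.2) a.1 a.1
      rw [if_pos rfl, real_inner_self_eq_norm_sq, real_inner_self_eq_norm_sq] at this
      rw [(sq_eq_sq₀ (norm_nonneg _) (norm_nonneg _)).1 this]
      exact F.norm_normal_le _
  have hpair : ∀ i j, -(D i j ^ 2 + D j i ^ 2) / 2 ≤ (lam j * D i j) * (lam i * D j i) := by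
    intro i j
    by_cases h : i = j
    · subst h
      nlinarith [sq_nonneg (lam i * D i i), sq_nonneg (D i i)]
    · have h1 := hlam i j h
      have h2 : |lam i * lam j * (D i j * D j i)| ≤ |D i j * D j i| := by
        rw [abs_mul]
        exact mul_le_of_le_one_left (abs_nonneg _) h1
      have h3 : |D i j * D j i| ≤ (D i j ^ 2 + D j i ^ 2) / 2 := by
        rw [abs_le]
        constructor <;> nlinarith [sq_nonneg (D i j - D j i), sq_nonneg (D i j + D j i)]
      have := (abs_le.1 (h2.trans h3)).1
      linarith
  have hsum : -(∑ i, ∑ j, D i j ^ 2) ≤ ∑ i, ∑ j, (lam j * D i j) * (lam i * D j i) := by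
    refine le_trans (le_of_eq ?_) (Finset.sum_le_sum fun i _ => Finset.sum_le_sum fun j _ =>
      hpair i j)
    have hsym : ∑ i, ∑ j, D j i ^ 2 = ∑ i, ∑ j, D i j ^ 2 := Finset.sum_comm
    simp only [← Finset.sum_div, Finset.sum_neg_distrib, Finset.sum_add_distrib, hsym]
    ring
  linarith

/-- A vector normal to `G(n,m)` at `P`, such as the acceleration of a geodesic, has no component along
`f₁ ∧ ⋯ ∧ νⱼ ∧ ⋯ ∧ fₙ`. -/
theorem inner_wedge_update_normal_eq_zero (F : IsPrincipalFrame Ω P lam s f ν) {a : NVec n m}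
    (ha : ∀ w, IsTangent P w → inner ℝ a w = (0 : ℝ)) (i j : Fin n) :
    inner ℝ (exteriorPower.ιMulti ℝ n (Function.update f i (ν j))) a = (0 : ℝ) := by
  rcases F.normal_unit j with h | h
  · rw [h, AlternatingMap.map_update_zero, inner_zero_left]
  · rw [real_inner_comm]
    refine ha _ ?_
    rw [← F.wedge]
    exact isTangent_wedge_update F.orthonormal (fun k => F.inner_normal k j) h i

theorem deriv_deriv_neg_log_evalForm_nonneg (F : IsPrincipalFrame Ω P lam s f ν)
    (hlam : ∀ i j, i ≠ j → |lam i * lam j| ≤ 1) {γ : ℝ → NVec n m} {t : ℝ}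
    (hγ : ContDiffAt ℝ 2 γ t) (hGr : ∀ᶠ r in 𝓝 t, γ r ∈ Gr n m) (hP : γ t = P)
    (hgeo : ∀ w, IsTangent P w → inner ℝ (deriv (deriv γ) t) w = (0 : ℝ)) :
    ContDiffAt ℝ 2 (fun r => -Real.log (evalForm Ω (γ r))) t ∧
      0 ≤ deriv (deriv fun r => -Real.log (evalForm Ω (γ r))) t := by
  set y : ℝ → ℝ := fun r => evalForm Ω (γ r) with hy
  set g : ℝ → ℝ := fun r => inner ℝ P (γ r) with hg
  set q : Fin n → Fin n → ℝ → ℝ := fun i j r =>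
    lam j * inner ℝ (exteriorPower.ιMulti ℝ n (Function.update f i (ν j))) (γ r) with hq
  set X : ℝ → Matrix (Fin n) (Fin n) ℝ := fun r => 1 - Matrix.of fun i j => q i j r / g r with hX
  have hyC : ContDiffAt ℝ 2 y t :=
    (LinearMap.toContinuousLinearMap (evalForm Ω)).contDiff.contDiffAt.comp t hγ
  have hgC : ContDiffAt ℝ 2 g t := contDiffAt_const.inner ℝ hγ
  have hqC : ∀ i j, ContDiffAt ℝ 2 (q i j) t := fun i j =>
    contDiffAt_const.mul (contDiffAt_const.inner ℝ hγ)
  have hy0 : y t = ∏ i, s i := by rw [hy, ← F.evalForm_self, ← hP]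
  have hypos : 0 < y t := hy0 ▸ F.prod_scale_pos
  -- Jets of `g` and of the `q i j` at `t`.
  obtain ⟨hγ1, hγ2⟩ := inner_deriv_deriv_of_norm_eq_one hγ
    (hGr.mono fun r hr => inner_self_of_mem_Gr hr)
  rw [hP] at hγ1 hγ2
  have hg0 : g t = 1 := by
    simp only [hg, hP]
    exact hP ▸ inner_self_of_mem_Gr hGr.self_of_nhds
  have hg1 : deriv g t = 0 :=
    (deriv_continuousLinearMap_comp (innerSL ℝ P) (hγ.differentiableAt (by simp))).trans hγ1
  have hg2 : deriv (deriv g) t = -‖deriv γ t‖ ^ 2 :=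
    (deriv_deriv_continuousLinearMap_comp (innerSL ℝ P) hγ).trans hγ2
  have hq0 : ∀ i j, q i j t = 0 := fun i j => by
    simp only [hq, hP]
    rw [← F.wedge, inner_wedge_update_wedge (fun k => F.inner_normal k j), mul_zero]
  have hq1 : ∀ i j, deriv (q i j) t = lam j *
      inner ℝ (exteriorPower.ιMulti ℝ n (Function.update f i (ν j))) (deriv γ t) := fun i j =>
    deriv_continuousLinearMap_comp
      (lam j • innerSL ℝ (exteriorPower.ιMulti ℝ n (Function.update f i (ν j))))
      (hγ.differentiableAt (by simp))
  have hq2 : ∀ i j, deriv (deriv (q i j)) t = 0 := fun i j => by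
    refine (deriv_deriv_continuousLinearMap_comp
      (lam j • innerSL ℝ (exteriorPower.ιMulti ℝ n (Function.update f i (ν j)))) hγ).trans ?_
    simp [F.inner_wedge_update_normal_eq_zero hgeo i j]
  -- Jet of `X` at `t`.
  have hXC : ∀ i j, ContDiffAt ℝ 2 (fun r => X r i j) t := fun i j =>
    contDiffAt_const.sub ((hqC i j).div hgC (by simp [hg0]))
  have hX0 : X t = 1 := by
    ext i j
    simp [hX, hq0]
  have hX1 : ∀ i j, deriv (fun r => X r i j) t = -deriv (q i j) t := fun i j => by
    rw [← (deriv_div_of_eq_one (hqC i j) hgC (hq0 i j) hg0 hg1).1]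
    exact deriv_const_sub _
  have hX2 : ∀ i j, deriv (deriv fun r => X r i j) t = 0 := fun i j => by
    have e : deriv (fun r => X r i j) = fun r => -deriv (fun r => q i j r / g r) r :=
      funext fun r => deriv_const_sub _
    rw [e, deriv.fun_neg, (deriv_div_of_eq_one (hqC i j) hgC (hq0 i j) hg0 hg1).2, hq2, neg_zero]
  -- Jet of `y` at `t`.
  have hdC : ContDiffAt ℝ 2 (fun r => (X r).det) t := contDiffAt_det hXC
  have e : y =ᶠ[𝓝 t] fun r => (∏ i, s i) * (g r * (X r).det) := by
    filter_upwards [hGr, hgC.continuousAt.eventually_ne (by simp [hg0] : g t ≠ 0)] with r hr hgr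
    exact F.evalForm_eq hr hgr
  have hy1 : deriv y t = (∏ i, s i) * deriv (fun r => (X r).det) t := by
    rw [e.deriv_eq, deriv_const_mul_field, deriv_fun_mul (hgC.differentiableAt (by simp))
      (hdC.differentiableAt (by simp)), hg0, hg1]
    simp
  have hy2 : deriv (deriv y) t = (∏ i, s i) *
      (-‖deriv γ t‖ ^ 2 + deriv (deriv fun r => (X r).det) t) := by
    have e' : deriv (fun r => (∏ i, s i) * (g r * (X r).det))
        = fun r => (∏ i, s i) * deriv (fun r => g r * (X r).det) r :=
      funext fun r => deriv_const_mul_field _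
    rw [e.deriv.deriv_eq, e', deriv_const_mul_field, deriv_deriv_mul hgC hdC, hg0, hg1, hg2, hX0]
    simp
  have hprod := F.prod_scale_pos.ne'
  refine ⟨(hyC.log hypos.ne').neg, ?_⟩
  rw [deriv_deriv_neg_log hyC hypos.ne', hy0, hy1, hy2, mul_div_cancel_left₀ _ hprod,
    mul_div_cancel_left₀ _ hprod, deriv_deriv_det_of_eq_one hXC hX0,
    deriv_det_of_eq_one (fun i j => (hXC i j).differentiableAt (by simp)) hX0]
  have := F.hessian_nonneg hlam (deriv γ t)
  simp only [hX1, hX2, hq1, neg_mul_neg, Finset.sum_const_zero, add_zero]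
  linarith

end IsPrincipalFrame

/-! ### Construction of principal frames from singular vectors -/

variable {Ω : Ambient n m [⋀^Fin n]→ₗ[ℝ] ℝ} {Q : Submodule ℝ (Ambient n m)}

theorem IsSimpleUnitFormDualTo.finrank_eq (hΩ : IsSimpleUnitFormDualTo Ω Q) :
    Module.finrank ℝ Q = n := by
  obtain ⟨a, ha, rfl, -⟩ := hΩ
  rw [finrank_span_eq_card ha.linearIndependent, Fintype.card_fin]

/-- Right singular vectors of `L` form an orthonormal basis of `Q`, which can be chosen with the
orientation given by `Ω`. -/
theorem exists_singular_basis (hn : 1 ≤ n) (hΩ : IsSimpleUnitFormDualTo Ω Q) (L : Q →ₗ[ℝ] Qᗮ) :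
    ∃ w : Fin n → Q, Orthonormal ℝ w ∧
      (∀ i j, inner ℝ (L (w i)) (L (w j)) = if i = j then L.singularValues i ^ 2 else 0) ∧
      ∀ v : Fin n → Ambient n m,
        Ω v = Matrix.det (Matrix.of fun i j => inner ℝ (w i : Ambient n m) (v j)) := by
  have hfin := hΩ.finrank_eq
  obtain ⟨a, ha, hQ, hform⟩ := hΩ
  have hT := L.isSymmetric_adjoint_comp_self
  set u := hT.eigenvectorBasis hfin with hu
  have huL : ∀ i j, inner ℝ (L (u i)) (L (u j)) = if i = j then L.singularValues i ^ 2 else 0 := by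
    intro i j
    rw [← LinearMap.adjoint_inner_left, ← LinearMap.comp_apply, hu, hT.apply_eigenvectorBasis hfin,
      inner_smul_left, orthonormal_iff_ite.1 (hT.eigenvectorBasis hfin).orthonormal,
      L.sq_singularValues_fin hfin]
    simp
  have huo : Orthonormal ℝ fun i => (u i : Ambient n m) :=
    u.orthonormal.comp_linearIsometry Q.subtypeₗᵢ
  have hspan : Submodule.span ℝ (Set.range fun i => (u i : Ambient n m)) = Q := by
    have h := congrArg (Submodule.map Q.subtype) u.toBasis.span_eq
    rw [Submodule.map_span, Submodule.map_top, Submodule.range_subtype, ← Set.range_comp] at h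
    simpa [Function.comp_def] using h
  have hmem : ∀ i, a i ∈ Submodule.span ℝ (Set.range fun i => (u i : Ambient n m)) := fun i => by
    rw [hspan, ← hQ]
    exact Submodule.subset_span ⟨i, rfl⟩
  set U : Matrix (Fin n) (Fin n) ℝ := Matrix.of fun i j => inner ℝ (a i) (u j : Ambient n m)
  have hU : U.det ^ 2 = 1 := sq_det_inner_eq_one huo ha hmem
  -- Multiplying the first eigenvector by the sign `det U` corrects the orientation.
  set σ : Fin n → ℝ := Function.update 1 ⟨0, hn⟩ U.det with hσ
  have hσ2 : ∀ i, σ i * σ i = 1 := fun i => by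
    by_cases hi : i = ⟨0, hn⟩
    · rw [hσ, hi, Function.update_self, ← sq, hU]
    · simp [hσ, hi]
  have hσp : ∏ i, σ i = U.det := by
    rw [hσ, Finset.prod_update_of_mem (Finset.mem_univ _)]
    simp
  refine ⟨fun i => σ i • u i, ?_, fun i j => ?_, fun v => ?_⟩
  · rw [orthonormal_iff_ite]
    intro i j
    change inner ℝ (σ i • (u i : Ambient n m)) (σ j • (u j : Ambient n m)) = _
    rw [inner_smul_left, inner_smul_right, orthonormal_iff_ite.1 huo]
    split_ifs with h
    · subst h; simpa using hσ2 i
    · simp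
  · rw [map_smul, map_smul, inner_smul_left, inner_smul_right, huL]
    split_ifs with h
    · subst h; rw [conj_trivial, ← mul_assoc, hσ2, one_mul]
    · simp
  · have h1 : (Matrix.of fun i j => inner ℝ (a i) (v j))
        = U * Matrix.of fun i j => inner ℝ (u i : Ambient n m) (v j) := by
      ext i j
      rw [Matrix.mul_apply]
      exact inner_eq_sum_of_mem_span huo (hmem i) (v j)
    rw [hform, h1, Matrix.det_mul, ← hσp, ← Matrix.det_mul_column]
    congr 1
    ext i j
    simp [inner_smul_left]

theorem mem_graphOver (L : Q →ₗ[ℝ] Qᗮ) (x : Q) :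
    (x : Ambient n m) + (L x : Ambient n m) ∈ graphOver Q L :=
  ⟨x, rfl⟩

/-- With `w i` the right singular vectors of `L`, the basis `f` of the graph consists of the normalized
`w i + L (w i)`, and `ν i` is `w i` and `L (w i)` combined orthogonally to it. -/
theorem exists_isPrincipalFrame (hn : 1 ≤ n) (hΩ : IsSimpleUnitFormDualTo Ω Q) {L : Q →ₗ[ℝ] Qᗮ}
    {P : NVec n m} (hP : IsOrientedPlane P (graphOver Q L)) (hpos : 0 < evalForm Ω P) :
    ∃ (s : Fin n → ℝ) (f ν : Fin n → Ambient n m),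
      IsPrincipalFrame Ω P (fun i => L.singularValues i) s f ν := by
  obtain ⟨w, hw, hLw, hform⟩ := exists_singular_basis hn hΩ L
  set lam : Fin n → ℝ := fun i => L.singularValues i with hlam
  set A : Fin n → Ambient n m := fun i => w i with hA
  set B : Fin n → Ambient n m := fun i => L (w i) with hB
  have hAA : ∀ i j, inner ℝ (A i) (A j) = if i = j then (1 : ℝ) else 0 := fun i j =>
    orthonormal_iff_ite.1 hw i j
  have hBB : ∀ i j, inner ℝ (B i) (B j) = if i = j then lam i ^ 2 else 0 := hLw
  have hAB : ∀ i j, inner ℝ (A i) (B j) = (0 : ℝ) := fun i j =>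
    Submodule.inner_right_of_mem_orthogonal (w i).2 (L (w j)).2
  have hBA : ∀ i j, inner ℝ (B i) (A j) = (0 : ℝ) := fun i j => by rw [real_inner_comm, hAB]
  have hB0 : ∀ i, lam i = 0 → B i = 0 := fun i hi => by
    rw [← inner_self_eq_zero (𝕜 := ℝ), hBB, if_pos rfl, hi]; simp
  set s : Fin n → ℝ := fun i => (√(1 + lam i ^ 2))⁻¹ with hs
  have hs0 : ∀ i, 0 < s i := fun i => by positivity
  have hs2 : ∀ i, s i ^ 2 * (1 + lam i ^ 2) = 1 := fun i => by
    rw [hs]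
    have : 0 < 1 + lam i ^ 2 := by positivity
    simp only [inv_pow, Real.sq_sqrt this.le]
    exact inv_mul_cancel₀ this.ne'
  set f : Fin n → Ambient n m := fun i => s i • (A i + B i) with hf
  -- Where `lam i = 0`, also `B i = 0`, and the convention `0⁻¹ = 0` makes `ν i` vanish.
  set ν : Fin n → Ambient n m := fun i => s i • ((lam i)⁻¹ • B i - lam i • A i) with hν
  have hfo : Orthonormal ℝ f := by
    rw [orthonormal_iff_ite]
    intro i j
    simp only [hf, inner_smul_left, inner_smul_right, inner_add_left, inner_add_right, hAA, hAB,
      hBA, hBB, conj_trivial]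
    split_ifs with h
    · subst h; linarith [hs2 i]
    · simp
  have hwedge : exteriorPower.ιMulti ℝ n f = P := by
    obtain ⟨e, he, hspan, rfl⟩ := hP
    have hΩf : 0 < Ω f := by
      rw [hform, show (Matrix.of fun i j => inner ℝ (w i : Ambient n m) (f j))
        = Matrix.diagonal s from ?_, Matrix.det_diagonal]
      · exact Finset.prod_pos fun i _ => hs0 i
      · ext i j
        rw [Matrix.of_apply, Matrix.diagonal_apply]
        change inner ℝ (A i) (f j) = _
        simp only [hf, inner_smul_right, inner_add_right, hAA, hAB]
        split_ifs with h <;> simp [h]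
    rcases wedge_eq_or_eq_neg he hfo fun i => by
      rw [hspan]; exact Submodule.smul_mem _ _ (mem_graphOver L (w i)) with h | h
    · exact h.symm
    · rw [h, map_neg, evalForm_wedge] at hpos
      linarith
  refine ⟨s, f, ν, hfo, hwedge, fun i j h => ?_, fun i => ?_, fun i j => ?_, fun v => ?_, hs0, hs2⟩
  · simp [hν, inner_smul_left, inner_smul_right, inner_sub_left, inner_sub_right, hAA, hAB, hBA,
      hBB, h]
  · by_cases h : lam i = 0
    · left; simp [hν, h]
    · right
      have h1 : inner ℝ (ν i) (ν i) = (1 : ℝ) := by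
        simp only [hν, inner_smul_left, inner_smul_right, inner_sub_left, inner_sub_right, hAA,
          hAB, hBA, hBB, conj_trivial, if_true]
        have := hs2 i
        field_simp
        linarith
      rw [norm_eq_sqrt_real_inner, h1, Real.sqrt_one]
  · simp only [hf, hν, inner_smul_left, inner_smul_right, inner_add_left, inner_sub_right, hAA,
      hAB, hBA, hBB, conj_trivial]
    split_ifs with h
    · subst h
      by_cases h : lam i = 0
      · simp [h]
      · field_simp; ring
    · simp
  · rw [hform]
    congr 1
    ext i j
    have hAi : A i = s i • (f i - lam i • ν i) := by
      have h2 : lam i • (lam i)⁻¹ • B i = B i := by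
        by_cases h : lam i = 0
        · rw [hB0 i h]; simp
        · rw [smul_smul, mul_inv_cancel₀ h, one_smul]
      have h3 : f i - lam i • ν i = (s i * (1 + lam i ^ 2)) • A i := by
        simp only [hf, hν]
        rw [smul_comm (lam i) (s i), ← smul_sub, smul_sub (lam i), h2]
        module
      rw [h3, smul_smul, ← mul_assoc, ← sq, hs2, one_smul]
    rw [Matrix.of_apply, Matrix.of_apply, show (w i : Ambient n m) = A i from rfl, hAi]
    rw [real_inner_smul_left (f i - _), inner_sub_left, real_inner_smul_left (ν i)]

/-- A plane on which `Ω` does not vanish is a graph over `Q`. -/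
theorem exists_isOrientedPlane_graphOver (hΩ : IsSimpleUnitFormDualTo Ω Q) {P : NVec n m}
    (hP : P ∈ Gr n m) (hpos : evalForm Ω P ≠ 0) :
    ∃ L : Q →ₗ[ℝ] Qᗮ, IsOrientedPlane P (graphOver Q L) := by
  obtain ⟨a, ha, hQ, hform⟩ := hΩ
  obtain ⟨_, e, he, -, rfl⟩ := hP
  rw [evalForm_wedge, hform] at hpos
  set M : Matrix (Fin n) (Fin n) ℝ := Matrix.of fun i j => inner ℝ (a i) (e j) with hM
  have hMu : IsUnit M.det := hpos.isUnit
  -- `W` is the basis of the plane that projects orthogonally to the basis `a` of `Q`.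
  set W : Fin n → Ambient n m := fun j => ∑ k, M⁻¹ k j • e k with hW
  have haW : ∀ i j, inner ℝ (a i) (W j) = (1 : Matrix (Fin n) (Fin n) ℝ) i j := fun i j => by
    rw [← Matrix.mul_nonsing_inv M hMu, Matrix.mul_apply]
    simp only [hW, inner_sum, inner_smul_right]
    exact Finset.sum_congr rfl fun k _ => by simp only [hM, Matrix.of_apply]; ring
  have hmem : ∀ j, W j - a j ∈ Qᗮ := fun j => by
    rw [Submodule.mem_orthogonal]
    intro x hx
    rw [← hQ] at hx
    rw [inner_eq_sum_of_mem_span ha hx]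
    refine Finset.sum_eq_zero fun i _ => ?_
    rw [inner_sub_right, haW, orthonormal_iff_ite.1 ha, Matrix.one_apply, sub_self, mul_zero]
  let L : Q →ₗ[ℝ] Qᗮ := ∑ j, LinearMap.smulRight (innerₛₗ ℝ (a j) ∘ₗ Q.subtype) ⟨_, hmem j⟩
  have hL : ∀ x : Q, (x : Ambient n m) + (L x : Ambient n m)
      = ∑ j, inner ℝ (a j) (x : Ambient n m) • W j := by
    intro x
    have hx : (x : Ambient n m) = ∑ j, inner ℝ (a j) (x : Ambient n m) • a j := by
      refine ext_inner_right ℝ fun y => ?_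
      rw [inner_eq_sum_of_mem_span ha (by rw [hQ]; exact x.2), sum_inner]
      exact Finset.sum_congr rfl fun i _ => by
        rw [inner_smul_left, conj_trivial, real_inner_comm]
    simp only [L, LinearMap.sum_apply, LinearMap.smulRight_apply, AddSubmonoidClass.coe_finsetSum,
      Submodule.coe_smul, LinearMap.comp_apply, Submodule.subtype_apply, innerₛₗ_apply_apply,
      smul_sub, Finset.sum_sub_distrib]
    rw [← hx]
    abel
  refine ⟨L, e, he, le_antisymm ?_ ?_, rfl⟩
  · rw [Submodule.span_le]
    rintro _ ⟨k, rfl⟩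
    have hxQ : ∑ j, M j k • a j ∈ Q := by
      rw [← hQ]
      exact Submodule.sum_mem _ fun j _ => Submodule.smul_mem _ _ (Submodule.subset_span ⟨j, rfl⟩)
    convert mem_graphOver L ⟨_, hxQ⟩
    rw [hL]
    have h1 : ∀ j, inner ℝ (a j) (∑ i, M i k • a i) = M j k := fun j => by
      simp [inner_sum, inner_smul_right, orthonormal_iff_ite.1 ha]
    simp only [h1, hW, Finset.smul_sum, smul_smul]
    rw [Finset.sum_comm]
    simp only [← Finset.sum_smul]
    have h2 : ∀ l, ∑ j, M j k * M⁻¹ l j = (1 : Matrix (Fin n) (Fin n) ℝ) l k := fun l => by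
      rw [← Matrix.nonsing_inv_mul M hMu, Matrix.mul_apply]
      exact Finset.sum_congr rfl fun j _ => mul_comm _ _
    simp [h2, Matrix.one_apply]
  · rintro _ ⟨x, rfl⟩
    change (x : Ambient n m) + (L x : Ambient n m) ∈ _
    rw [hL]
    exact Submodule.sum_mem _ fun j _ => Submodule.smul_mem _ _ <|
      Submodule.sum_mem _ fun k _ => Submodule.smul_mem _ _ (Submodule.subset_span ⟨k, rfl⟩)

/-! ### The superlevel set `Ω ≥ 1/2` -/

theorem IsPrincipalFrame.mul_le_one {P : NVec n m} {lam s : Fin n → ℝ} {f ν : Fin n → Ambient n m}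
    (F : IsPrincipalFrame Ω P lam s f ν) (hP : 1 / 2 ≤ evalForm Ω P) {i j : Fin n} (hij : i ≠ j) :
    |lam i * lam j| ≤ 1 := by
  have hs1 : ∀ k, s k ≤ 1 := fun k => by
    have h1 := F.scale_sq k
    have h2 := F.scale_pos k
    nlinarith [mul_nonneg (sq_nonneg (s k)) (sq_nonneg (lam k))]
  rw [F.evalForm_self, ← Finset.mul_prod_erase _ _ (Finset.mem_univ i),
    ← Finset.mul_prod_erase _ _ (Finset.mem_erase.2 ⟨hij.symm, Finset.mem_univ j⟩),
    ← mul_assoc] at hP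
  have h1 : 1 / 2 ≤ s i * s j := hP.trans <|
    mul_le_of_le_one_right (mul_pos (F.scale_pos i) (F.scale_pos j)).le <|
      Finset.prod_le_one (fun k _ => (F.scale_pos k).le) fun k _ => hs1 k
  have h2 : 1 / 4 ≤ s i ^ 2 * s j ^ 2 := by nlinarith
  have h3 : (s i ^ 2 * s j ^ 2) * ((1 + lam i ^ 2) * (1 + lam j ^ 2)) = 1 := by
    linear_combination (s j ^ 2 * (1 + lam j ^ 2)) * F.scale_sq i + F.scale_sq j
  have h4 : (1 + lam i ^ 2) * (1 + lam j ^ 2) ≤ 4 := by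
    have : 0 ≤ (1 + lam i ^ 2) * (1 + lam j ^ 2) := by positivity
    nlinarith
  -- `(1 + |λᵢ λⱼ|)² ≤ (1 + λᵢ²) (1 + λⱼ²)` by Cauchy-Schwarz.
  rw [abs_le]
  constructor <;> nlinarith [sq_nonneg (lam i - lam j), sq_nonneg (lam i + lam j)]

/-- The graph of `a₁ ↦ (12/5) b`, `aᵢ ↦ 0` for `i ≠ 1`, with `b` a unit vector in `Qᗮ`, lies in `Ξ`, since
a map of rank one has a single nonzero singular value. There `Ω` equals `5/13`. -/
theorem exists_mem_Xi_evalForm_lt (hn : 1 ≤ n) (hm : 1 ≤ m) (hΩ : IsSimpleUnitFormDualTo Ω Q) :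
    ∃ P ∈ Xi Ω Q, evalForm Ω P < 1 / 2 := by
  have hfin := hΩ.finrank_eq
  obtain ⟨a, ha, hQ, hform⟩ := hΩ
  obtain ⟨b, hb, hb1⟩ : ∃ b ∈ Qᗮ, ‖b‖ = 1 := by
    have hne : Qᗮ ≠ ⊥ := by
      rw [Ne, Submodule.orthogonal_eq_bot_iff]
      rintro rfl
      rw [finrank_top, finrank_euclideanSpace_fin] at hfin
      omega
    obtain ⟨b, hb, hb0⟩ := Submodule.exists_mem_ne_zero_of_ne_bot hne
    exact ⟨‖b‖⁻¹ • b, Submodule.smul_mem _ _ hb, by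
      rw [norm_smul, norm_inv, norm_norm, inv_mul_cancel₀ (norm_ne_zero_iff.2 hb0)]⟩
  set z : Fin n := ⟨0, hn⟩
  have hab : ∀ i, inner ℝ (a i) b = (0 : ℝ) := fun i =>
    Submodule.inner_right_of_mem_orthogonal (by rw [← hQ]; exact Submodule.subset_span ⟨i, rfl⟩) hb
  set c : Ambient n m := (5 / 13 : ℝ) • a z + (12 / 13 : ℝ) • b with hc
  have hac : ∀ i, inner ℝ (a i) c = if i = z then (5 / 13 : ℝ) else 0 := fun i => by
    rw [hc, inner_add_right, inner_smul_right, inner_smul_right, hab,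
      orthonormal_iff_ite.1 ha]
    simp
  have he : Orthonormal ℝ (Function.update a z c) := by
    refine orthonormal_update ha ?_ fun k hk => by rw [hac, if_neg hk]
    simp only [hc, inner_add_left, inner_add_right, inner_smul_left, inner_smul_right, hab,
      real_inner_comm (a z) b, real_inner_self_eq_norm_sq, ha.1, hb1, conj_trivial]
    norm_num
  have hval : evalForm Ω (exteriorPower.ιMulti ℝ n (Function.update a z c)) = 5 / 13 := by
    rw [evalForm_wedge, hform, show (Matrix.of fun i j => inner ℝ (a i) (Function.update a z c j))
      = Matrix.diagonal (Function.update (1 : Fin n → ℝ) z (5 / 13)) from ?_, Matrix.det_diagonal,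
      Finset.prod_update_of_mem (Finset.mem_univ z)]
    · simp
    · ext i j
      rw [Matrix.of_apply, Matrix.diagonal_apply]
      by_cases hj : j = z
      · subst hj
        rw [Function.update_self, hac]
        split_ifs with h <;> simp [h]
      · rw [Function.update_of_ne hj, orthonormal_iff_ite.1 ha]
        split_ifs with h
        · subst h; simp [hj]
        · rfl
  let L : Q →ₗ[ℝ] Qᗮ :=
    LinearMap.smulRight ((12 / 5 : ℝ) • (innerₛₗ ℝ (a z) ∘ₗ Q.subtype)) ⟨b, hb⟩
  have hL : ∀ x : Q, (L x : Ambient n m) = (12 / 5 * inner ℝ (a z) (x : Ambient n m)) • b :=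
    fun x => rfl
  have hrank : ∀ i : ℕ, 1 ≤ i → L.singularValues i = 0 := fun i hi => by
    rw [LinearMap.singularValues_eq_zero_iff_le_finrank_range]
    refine le_trans ?_ hi
    have hle : LinearMap.range L ≤ Submodule.span ℝ {(⟨b, hb⟩ : Qᗮ)} := by
      rintro _ ⟨x, rfl⟩
      exact Submodule.smul_mem _ _ (Submodule.mem_span_singleton_self _)
    exact (Submodule.finrank_mono hle).trans ((finrank_span_le_card _).trans (by simp))
  refine ⟨exteriorPower.ιMulti ℝ n (Function.update a z c), ⟨by rw [hval]; norm_num, L,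
    ⟨_, he, le_antisymm ?_ ?_, rfl⟩, fun i j hij => ?_⟩, by rw [hval]; norm_num⟩
  · rw [Submodule.span_le]
    rintro _ ⟨k, rfl⟩
    have hk : a k ∈ Q := by rw [← hQ]; exact Submodule.subset_span ⟨k, rfl⟩
    have h := mem_graphOver L ⟨a k, hk⟩
    rw [hL] at h
    by_cases hkz : k = z
    · subst hkz
      have h' := Submodule.smul_mem _ (5 / 13 : ℝ) h
      simp only [real_inner_self_eq_norm_sq, ha.1] at h'
      have e : c = (5 / 13 : ℝ) • (a z + (12 / 5 * 1 ^ 2 : ℝ) • b) := by rw [hc]; module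
      rw [Function.update_self, e]
      exact h'
    · rw [Function.update_of_ne hkz]
      simpa [ha.inner_eq_zero (Ne.symm hkz)] using h
  · rintro _ ⟨x, rfl⟩
    change (x : Ambient n m) + (L x : Ambient n m) ∈ _
    rw [hL]
    have key : ∀ y ∈ Submodule.span ℝ (Set.range a), y + (12 / 5 * inner ℝ (a z) y) • b ∈
        Submodule.span ℝ (Set.range (Function.update a z c)) := by
      intro y hy
      induction hy using Submodule.span_induction with
      | mem y hy =>
        obtain ⟨k, rfl⟩ := hy
        have hk := Submodule.subset_span (R := ℝ)
          (Set.mem_range_self (f := Function.update a z c) k)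
        by_cases hkz : k = z
        · subst hkz
          rw [Function.update_self] at hk
          have e : a z + (12 / 5 * 1 ^ 2 : ℝ) • b = (13 / 5 : ℝ) • c := by rw [hc]; module
          rw [real_inner_self_eq_norm_sq, ha.1, e]
          exact Submodule.smul_mem _ _ hk
        · rw [Function.update_of_ne hkz] at hk
          simpa [ha.inner_eq_zero (Ne.symm hkz)] using hk
      | zero => simp
      | add y y' _ _ hy hy' =>
        have e : y + y' + (12 / 5 * inner ℝ (a z) (y + y')) • b
            = (y + (12 / 5 * inner ℝ (a z) y) • b) + (y' + (12 / 5 * inner ℝ (a z) y') • b) := by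
          rw [inner_add_right]
          module
        rw [e]
        exact Submodule.add_mem _ hy hy'
      | smul r y _ hy =>
        have e : r • y + (12 / 5 * inner ℝ (a z) (r • y)) • b
            = r • (y + (12 / 5 * inner ℝ (a z) y) • b) := by
          rw [inner_smul_right]
          module
        rw [e]
        exact Submodule.smul_mem _ r hy
    exact key x (by rw [hQ]; exact x.2)
  · have h0 : L.singularValues i * L.singularValues j = 0 := by
      rcases Nat.eq_zero_or_pos i with h | h
      · rw [hrank j (by have := Fin.val_ne_of_ne hij; omega), mul_zero]
      · rw [hrank i h, zero_mul]
    rw [h0, abs_zero]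
    exact zero_le_one

/-! ### Convexity -/

theorem hessianNonnegOn_neg_log (hn : 1 ≤ n) (hΩ : IsSimpleUnitFormDualTo Ω Q) :
    HessianNonnegOn (fun P => -Real.log (evalForm Ω P)) (Xi Ω Q) := by
  rintro γ I hI - ⟨hγ, hGr, hgeo⟩ t ht ⟨hpos, L, hP, hlam⟩
  obtain ⟨s, f, ν, F⟩ := exists_isPrincipalFrame hn hΩ hP hpos
  have hIt := hI.mem_nhds ht
  exact F.deriv_deriv_neg_log_evalForm_nonneg hlam
    ((hγ.contDiffAt hIt).of_le ENat.LEInfty.out) (Filter.mem_of_superset hIt hGr) rfl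
    (hgeo t ht)

theorem HessianNonnegOn.geodesicallyConvexOn {f : NVec n m → ℝ} {S : Set (NVec n m)}
    (h : HessianNonnegOn f S) : GeodesicallyConvexOn f S := by
  intro γ I hI hconn hγ J hJI hJ hJS
  have key := fun t (ht : t ∈ J) => h γ I hI hconn hγ t (hJI ht) (hJS t ht)
  refine convexOn_of_deriv2_nonneg' hJ (fun t ht => ?_) (fun t ht => ?_) fun t ht => (key t ht).2
  · exact ((key t ht).1.differentiableAt (by simp)).differentiableWithinAt
  · exact (differentiableAt_deriv_of_contDiffAt_two (key t ht).1).differentiableWithinAt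

end Grassmann

theorem theoremB (n m : ℕ) (hn : 1 ≤ n) (hm : 1 ≤ m)
    (Ω : Grassmann.Ambient n m [⋀^Fin n]→ₗ[ℝ] ℝ)
    (Q : Submodule ℝ (Grassmann.Ambient n m))
    (hΩ : Grassmann.IsSimpleUnitFormDualTo Ω Q) :
    Grassmann.HessianNonnegOn (fun P => -Real.log (Grassmann.evalForm Ω P)) (Grassmann.Xi Ω Q) ∧
    Grassmann.GeodesicallyConvexOn (fun P => -Real.log (Grassmann.evalForm Ω P))
      (Grassmann.Xi Ω Q) ∧
    {P | P ∈ Grassmann.Gr n m ∧ 1 / 2 ≤ Grassmann.evalForm Ω P} ⊂ Grassmann.Xi Ω Q := by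
  have hess := Grassmann.hessianNonnegOn_neg_log hn hΩ
  refine ⟨hess, hess.geodesicallyConvexOn, ?_, ?_⟩
  · rintro P ⟨hP, hle⟩
    have hpos : 0 < Grassmann.evalForm Ω P := by linarith
    obtain ⟨L, hL⟩ := Grassmann.exists_isOrientedPlane_graphOver hΩ hP hpos.ne'
    obtain ⟨s, f, ν, F⟩ := Grassmann.exists_isPrincipalFrame hn hΩ hL hpos
    exact ⟨hpos, L, hL, fun i j hij => F.mul_le_one hle hij⟩
  · intro hsub
    obtain ⟨P, hP, hlt⟩ := Grassmann.exists_mem_Xi_evalForm_lt hn hm hΩ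
    exact absurd (hsub hP).2 hlt.not_ge
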